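/- Throughout, $I=[0,1]$ and all maps are continuous. A subset $S$ of a space $X$ \emph{deforms to a point within $X$} if the inclusion $S\hookrightarrow X$ is homotopic to a constant map. A \emph{metric ANR} is a metrizable space which, whenever it is embedded as a closed subspace of a metrizable space, is a retract of some open neighbourhood of its image. The Lusternik--Schnirelmann category $\mathrm{cat}(X)$ is the least $n$ such that $X$ can be covered by $n$ open sets, each of which deforms to a point within $X$. Let $f\colon C\to W$ be a continuous map. Let $C^I$ be the space of paths $\alpha\colon I\to C$ with the compact-open topology, and let $\pi_f\colon C^I\to C\times W$ be given by $\pi_f(\alpha)=(\alpha(0),f(\alpha(1)))$. The complexity $\mathrm{TC}(f)$ is the least $n$ for which there is a filtration $\emptyset=Q_0\subseteq Q_1\subseteq\dots\subseteq Q_n=C\times W$ by closed sets such that $\pi_f$ admits a continuous partial section over $Q_i\setminus Q_{i-1}$ for $i=1,\dots,n$. A \emph{categorical section} of $f$ over $A\subseteq W$ is a continuous map $s\colon A\to C$ with $f(s(w))=w$ for all $w\in A$ such that $s(A)$ deforms to a point within $C$. The number $\mathrm{csec}(f)$ is the least $n$ for which there is a filtration $\emptyset=A_0\subseteq A_1\subseteq\dots\subseteq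 A_n=W$ by closed sets such that $f$ admits a categorical section over $A_i\setminus A_{i-1}$ for $i=1,\dots,n$. Each of these numbers is $\infty$ if no such $n$ exists. \textbf{Theorem.} Let $C$ be a (non-empty) path-connected space, let $W$ be a metric ANR, and let $f\colon C\to W$ be any continuous map. Then $$\mathrm{cat}(W)\le\mathrm{csec}(f)\le\mathrm{TC}(f),$$ and, whenever $\mathrm{csec}(f)+\mathrm{cat}(C)$ is finite, $$\mathrm{TC}(f)<\mathrm{csec}(f)+\mathrm{cat}(C).$$ -/

import Mathlib

open Topology Set
open scoped unitInterval

universe u v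

/-- A metric ANR: a metrizable space `W` which, whenever it is embedded as a closed subspace in a
metrizable space `X`, is a retract of an open neighbourhood of its image. -/
structure IsMetricANR (W : Type u) [TopologicalSpace W] : Prop where
  metrizable : TopologicalSpace.MetrizableSpace W
  exists_retraction : ∀ (X : Type u) [TopologicalSpace X] [TopologicalSpace.MetrizableSpace X]
    (e : W → X), IsClosedEmbedding e →
      ∃ U : Set X, IsOpen U ∧ range e ⊆ U ∧
        ∃ r : X → W, ContinuousOn r U ∧ ∀ w, r (e w) = w

/-- The subset `S` can be deformed to a point within `X`: the inclusion `S → X` is homotopic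
to a constant map. -/
def DeformsToPoint {X : Type u} [TopologicalSpace X] (S : Set X) : Prop :=
  ContinuousMap.Nullhomotopic (⟨Subtype.val, continuous_subtype_val⟩ : C(S, X))

/-- There is a filtration `∅ = Q 0 ⊆ Q 1 ⊆ ⋯ ⊆ Q n = X` by closed sets such that all the
successive differences `Q i - Q (i - 1)`, `1 ≤ i ≤ n`, have property `P`. -/
def HasClosedFiltration (X : Type u) [TopologicalSpace X] (P : Set X → Prop) (n : ℕ) : Prop :=
  ∃ Q : Fin (n + 1) → Set X, Q 0 = ∅ ∧ Q (Fin.last n) = univ ∧ Monotone Q ∧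
    (∀ i, IsClosed (Q i)) ∧ ∀ i : Fin n, P (Q i.succ \ Q i.castSucc)

/-- The (unnormalized) Lusternik-Schnirelmann category: the least `n` such that `X` can be covered
by `n` open sets, each of which can be deformed to a point within `X`; it is `⊤` if there
is no such `n`. -/
noncomputable def lsCat (X : Type u) [TopologicalSpace X] : ℕ∞ :=
  ⨅ (n : ℕ) (_ : ∃ U : Fin n → Set X,
    (∀ i, IsOpen (U i) ∧ DeformsToPoint (U i)) ∧ ⋃ i, U i = univ), (n : ℕ∞)

section MapInvariants

variable {C : Type u} {W : Type v} [TopologicalSpace C] [TopologicalSpace W]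

/-- The projection `π_f(α) = (α(0), f(α(1)))` from the space of paths in `C` (with the compact-open
topology) to `C × W`. -/
def pathProj (f : C(C, W)) (α : C(I, C)) : C × W :=
  (α 0, f (α 1))

/-- The map `π_f` has a continuous partial section over `Q`. -/
def HasPartialSection (f : C(C, W)) (Q : Set (C × W)) : Prop :=
  ∃ s : C(Q, C(I, C)), ∀ q : Q, pathProj f (s q) = q

/-- The map `f` has a categorical section over `A`: a continuous partial section `s` over `A`
whose image can be deformed to a point within `C`. -/
def HasCategoricalSection (f : C(C, W)) (A : Set W) : Prop :=
  ∃ s : C(A, C), (∀ w : A, f (s w) = w) ∧ DeformsToPoint (range s)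

/-- The topological complexity of the map `f`. -/
noncomputable def mapTC (f : C(C, W)) : ℕ∞ :=
  ⨅ (n : ℕ) (_ : HasClosedFiltration (C × W) (HasPartialSection f) n), (n : ℕ∞)

/-- The minimal length of a closed filtration of `W` with categorical sections of `f` over the
successive differences. -/
noncomputable def csec (f : C(C, W)) : ℕ∞ :=
  ⨅ (n : ℕ) (_ : HasClosedFiltration W (HasCategoricalSection f) n), (n : ℕ∞)

end MapInvariants

/-! By `hasPartialSection_iff`, a partial section of `pathProj f` over `Q` amounts to a homotopy on
`Q` from `(c, w) ↦ c` to some `v` with `f ∘ v = pr₂`. Fixing `c = c₀` turns it into a categorical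
section, so `csec f ≤ mapTC f`. Conversely, over `S ×ˢ A` with `S` contractible in `C` and `s` a
categorical section over `A`, path-connectedness joins `c` to `s w`; adding the ranks of two
filtrations gives the upper bound.

For `lsCat W ≤ csec f`, composing with `f` contracts each stratum in `W`. Strata are only locally
closed, so they must be thickened to open sets: this is where the ANR hypothesis enters, through
extension of maps from closed subsets of metrizable spaces. -/

/-! ### Extension of maps into metric ANRs -/

/-- **Dugundji extension theorem** for metrizable spaces and normed targets. -/
theorem exists_continuous_eqOn_of_isClosed {X E : Type*} [TopologicalSpace X]
    [TopologicalSpace.MetrizableSpace X] [NormedAddCommGroup E] [NormedSpace ℝ E]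
    {A : Set X} (hA : IsClosed A) {f : X → E} (hf : ContinuousOn f A) :
    ∃ F : X → E, Continuous F ∧ EqOn F f A := by
  classical
  let := TopologicalSpace.metrizableSpaceMetric X
  rcases A.eq_empty_or_nonempty with rfl | hne
  · exact ⟨0, continuous_const, eqOn_empty _ _⟩
  -- Off `A`, the value at `x` is confined to the hull of values at nearly nearest points of `A`.
  -- The factor 2 leaves slack: one such point `a` serves all nearby `x`, so `f a` is a locally
  -- constant choice.
  obtain ⟨g, hg⟩ := exists_continuous_forall_mem_convex_of_local_const
    (X := ↥Aᶜ) (E := E)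
    (t := fun x => convexHull ℝ (f '' (A ∩ Metric.ball (x : X) (2 * Metric.infDist (x : X) A))))
    (fun x => convex_convexHull ℝ _) (by
      rintro ⟨x, hx⟩
      have hpos : 0 < Metric.infDist x A := (hA.notMem_iff_infDist_pos hne).1 hx
      obtain ⟨a, haA, ha⟩ := (Metric.infDist_lt_iff hne).1
        (show Metric.infDist x A < 2 * Metric.infDist x A by linarith)
      refine ⟨f a, ?_⟩
      have hopen : IsOpen {y : ↥Aᶜ | dist (y : X) a < 2 * Metric.infDist (y : X) A} :=
        isOpen_lt (by fun_prop)
          (continuous_const.mul ((Metric.continuous_infDist_pt A).comp continuous_subtype_val))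
      filter_upwards [hopen.mem_nhds ha] with y hy
      refine subset_convexHull ℝ _ ⟨a, ⟨haA, ?_⟩, rfl⟩
      rw [Metric.mem_ball, dist_comm]
      exact hy)
  refine ⟨fun x => if hx : x ∈ A then f x else g ⟨x, hx⟩, ?_, fun x hx => dif_pos hx⟩
  rw [continuous_iff_continuousAt]
  intro x
  by_cases hx : x ∈ A
  · rw [Metric.continuousAt_iff]
    intro ε hε
    obtain ⟨δ, hδ, h⟩ := Metric.continuousOn_iff.1 hf x hx ε hε
    -- A point `a` used at `y` has `dist a y < 2 * dist y x`, hence `dist a x < 3 * dist y x < δ`.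
    refine ⟨δ / 3, by positivity, fun y hy => ?_⟩
    simp only [dif_pos hx]
    split_ifs with hyA
    · exact h y hyA (by linarith)
    · refine convexHull_min ?_ (convex_ball (f x) ε) (hg ⟨y, hyA⟩)
      rintro _ ⟨a, ⟨haA, ha⟩, rfl⟩
      have h1 : Metric.infDist y A ≤ dist y x := Metric.infDist_le_dist_of_mem hx
      have h2 : dist a y < 2 * Metric.infDist y A := ha
      exact h a haA (by linarith [dist_triangle a y x])
  · have hcont : ContinuousOn (fun x => if hx : x ∈ A then f x else g ⟨x, hx⟩) Aᶜ := by
      rw [continuousOn_iff_continuous_domRestrict]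
      refine g.continuous.congr fun y => ?_
      have hy : (y : X) ∉ A := y.2
      simp [domRestrict, hy]
    exact hcont.continuousAt (hA.isOpen_compl.mem_nhds hx)

/-- Every metrizable space embeds in a Banach space. -/
theorem exists_isEmbedding_normedSpace (W : Type u) [TopologicalSpace W]
    [TopologicalSpace.MetrizableSpace W] :
    ∃ (E : Type u) (_ : NormedAddCommGroup E) (_ : NormedSpace ℝ E) (k : W → E),
      IsEmbedding k := by
  let := TopologicalSpace.metrizableSpaceMetric W
  refine ⟨BoundedContinuousFunction W ℝ, inferInstance, inferInstance, ?_⟩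
  rcases isEmpty_or_nonempty W with hW | ⟨⟨w₀⟩⟩
  · exact ⟨fun _ => 0, IsEmbedding.of_subsingleton _⟩
  have hbound (w y : W) : ‖dist w y - dist w₀ y‖ ≤ dist w w₀ := by
    rw [Real.norm_eq_abs]
    exact abs_dist_sub_le w w₀ y
  refine ⟨fun w => BoundedContinuousFunction.ofNormedAddCommGroup
    (fun y => dist w y - dist w₀ y) (by fun_prop) (dist w w₀) (hbound w), ?_⟩
  refine (Isometry.of_dist_eq fun x y => le_antisymm ?_ ?_).isEmbedding
  · refine (BoundedContinuousFunction.dist_le dist_nonneg).2 fun z => ?_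
    simpa [Real.dist_eq] using abs_dist_sub_le x y z
  · refine le_trans ?_ (BoundedContinuousFunction.dist_coe_le_dist y)
    simp

/-- A metric ANR is an absolute neighbourhood extensor for metrizable spaces. -/
theorem IsMetricANR.exists_extension {W : Type u} [TopologicalSpace W] (hW : IsMetricANR W)
    {X : Type u} [TopologicalSpace X] [TopologicalSpace.MetrizableSpace X]
    {A : Set X} (hA : IsClosed A) {f : X → W} (hf : ContinuousOn f A) :
    ∃ U : Set X, IsOpen U ∧ A ⊆ U ∧ ∃ g : X → W, ContinuousOn g U ∧ EqOn g f A := by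
  have := hW.metrizable
  let := TopologicalSpace.metrizableSpaceMetric X
  obtain ⟨E, _, _, k, hk⟩ := exists_isEmbedding_normedSpace W
  rcases A.eq_empty_or_nonempty with rfl | hne
  · exact ⟨∅, isOpen_empty, Subset.rfl, f, hf, eqOn_empty _ _⟩
  obtain ⟨F, hF, hFA⟩ := exists_continuous_eqOn_of_isClosed hA (hk.continuous.comp_continuousOn hf)
  -- The image of `k` need not be closed in `E`. Deleting from `E × ℝ` the points of height 0
  -- outside it makes `W` the whole zero slice, hence closed.
  let Z := {p : E × ℝ // p.2 = 0 → p.1 ∈ range k}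
  let e : W → Z := fun w => ⟨(k w, 0), fun _ => mem_range_self w⟩
  have he : IsClosedEmbedding e := by
    refine ⟨?_, ?_⟩
    · refine IsEmbedding.of_comp (by fun_prop) (continuous_fst.comp continuous_subtype_val) hk
    · have : range e = {z : Z | z.1.2 = 0} := by
        ext z
        refine ⟨?_, fun hz => ?_⟩
        · rintro ⟨w, rfl⟩
          rfl
        · obtain ⟨w, hw⟩ := z.2 hz
          exact ⟨w, Subtype.ext (Prod.ext hw hz.symm)⟩
      rw [this]
      exact isClosed_eq (by fun_prop) continuous_const
  obtain ⟨V, hV, heV, r, hr, hre⟩ := hW.exists_retraction Z e he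
  have hmem (x : X) (h : Metric.infDist x A = 0) : x ∈ A := by
    by_contra hx
    exact ((hA.notMem_iff_infDist_pos hne).1 hx).ne' h
  -- Using the distance to `A` as height keeps the graph in `Z`: height 0 occurs only on `A`, where
  -- `F = k ∘ f`.
  let j : X → Z := fun x => ⟨(F x, Metric.infDist x A), fun h =>
    ⟨f x, (hFA (hmem x h)).symm⟩⟩
  have hj : Continuous j :=
    (hF.prodMk (Metric.continuous_infDist_pt A)).subtype_mk _
  have hjA (x : X) (hx : x ∈ A) : j x = e (f x) :=
    Subtype.ext (Prod.ext (hFA hx) (Metric.infDist_zero_of_mem hx))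
  refine ⟨j ⁻¹' V, hV.preimage hj, fun x hx => ?_, r ∘ j,
    hr.comp hj.continuousOn (mapsTo_preimage _ _), fun x hx => ?_⟩
  · rw [mem_preimage, hjA x hx]
    exact heV (mem_range_self _)
  · rw [Function.comp_apply, hjA x hx, hre]

/-! ### Thickening contractible sets -/

/-- A null-homotopy over a closed subset of a metrizable space extends to a neighbourhood, for maps
into a metric ANR. -/
theorem IsMetricANR.exists_isOpen_nullhomotopic {W : Type u} [TopologicalSpace W]
    (hW : IsMetricANR W) {X : Type u} [TopologicalSpace X] [TopologicalSpace.MetrizableSpace X]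
    (i : C(X, W)) {S : Set X} (hS : IsClosed S) (h : (i.restrict S).Nullhomotopic) :
    ∃ U : Set X, IsOpen U ∧ S ⊆ U ∧ (i.restrict U).Nullhomotopic := by
  classical
  obtain ⟨y, ⟨H⟩⟩ := h
  -- The homotopy on `S × I`, with `i` at the bottom and `y` at the top; only values on this closed
  -- union matter. After extension, the tube lemma finds a neighbourhood of `S` on which all times
  -- are defined.
  let φ : X × I → W := fun p => if hp : p.1 ∈ S then H (p.2, ⟨p.1, hp⟩)
    else if p.2 = 0 then i p.1 else y
  let B₀ : Set (X × I) := {p | p.2 = 0}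
  let B₁ : Set (X × I) := {p | p.2 = 1}
  let T : Set (X × I) := {p | p.1 ∈ S}
  have hB₀ : IsClosed B₀ := isClosed_eq continuous_snd continuous_const
  have hB₁ : IsClosed B₁ := isClosed_eq continuous_snd continuous_const
  have hT : IsClosed T := hS.preimage continuous_fst
  have hφ₀ (x : X) : φ (x, 0) = i x := by
    by_cases hx : x ∈ S <;> simp [φ, hx]
  have hφ₁ (x : X) : φ (x, 1) = y := by
    by_cases hx : x ∈ S <;> simp [φ, hx]
  have c₀ : ContinuousOn φ B₀ := by
    refine ContinuousOn.congr (f := fun p => i p.1) (by fun_prop) ?_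
    rintro ⟨x, t⟩ (rfl : t = 0)
    exact hφ₀ x
  have c₁ : ContinuousOn φ B₁ := by
    refine ContinuousOn.congr (f := fun _ => y) continuousOn_const ?_
    rintro ⟨x, t⟩ (rfl : t = 1)
    exact hφ₁ x
  have cT : ContinuousOn φ T := by
    rw [continuousOn_iff_continuous_domRestrict]
    have : Continuous fun p : T => H (p.1.2, ⟨p.1.1, p.2⟩) := by fun_prop
    refine this.congr fun p => ?_
    have hp : p.1.1 ∈ S := p.2
    simp [domRestrict, φ, hp]
  obtain ⟨N, hN, hsub, g, hg, hgφ⟩ := hW.exists_extension (hB₀.union (hB₁.union hT))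
    (c₀.union_of_isClosed (c₁.union_of_isClosed cT hB₁ hT) hB₀ (hB₁.union hT))
  have htube (x : X) (hx : x ∈ S) : ∃ u : Set X, IsOpen u ∧ x ∈ u ∧ u ×ˢ (univ : Set I) ⊆ N := by
    obtain ⟨u, v, hu, -, hxu, hv, huv⟩ := generalized_tube_lemma (isCompact_singleton (x := x))
      (isCompact_univ (X := I)) hN (by
        rintro ⟨x', t⟩ ⟨rfl, -⟩
        exact hsub (Or.inr (Or.inr hx)))
    exact ⟨u, hu, hxu rfl, (prod_mono_right hv).trans huv⟩
  choose! u hu hxu huN using htube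
  have hUN (x : X) (hx : x ∈ ⋃ s ∈ S, u s) (t : I) : (x, t) ∈ N := by
    obtain ⟨s, hs, hxs⟩ := mem_iUnion₂.1 hx
    exact huN s hs ⟨hxs, mem_univ t⟩
  refine ⟨⋃ s ∈ S, u s, isOpen_biUnion hu, fun x hx => mem_biUnion hx (hxu x hx), y, ⟨?_⟩⟩
  refine ⟨⟨fun p => g (p.2, p.1), ?_⟩, fun x => ?_, fun x => ?_⟩
  · exact hg.comp_continuous (by fun_prop) fun p => hUN _ p.2.2 _
  · exact (hgφ (Or.inl rfl)).trans (hφ₀ x)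
  · exact (hgφ (Or.inr (Or.inl rfl))).trans (hφ₁ x)

theorem DeformsToPoint.mono {X : Type u} [TopologicalSpace X] {S T : Set X} (hST : S ⊆ T)
    (hT : DeformsToPoint T) : DeformsToPoint S :=
  ContinuousMap.Nullhomotopic.comp_left hT (ContinuousMap.inclusion hST)

/-- A locally closed subset of a metric ANR which deforms to a point has an open neighbourhood which
deforms to a point. -/
theorem DeformsToPoint.exists_isOpen_superset {W : Type u} [TopologicalSpace W]
    (hW : IsMetricANR W) {S : Set W} (hS : IsLocallyClosed S) (h : DeformsToPoint S) :
    ∃ U : Set W, IsOpen U ∧ S ⊆ U ∧ DeformsToPoint U := by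
  have := hW.metrizable
  obtain ⟨V, K, hV, hK, rfl⟩ := hS
  let i : C(V, W) := ⟨Subtype.val, continuous_subtype_val⟩
  have hcl : IsClosed (i ⁻¹' K) := hK.preimage i.continuous
  let q : C(i ⁻¹' K, ↥(V ∩ K)) := ⟨fun x => ⟨x.1.1, x.1.2, x.2⟩, by fun_prop⟩
  obtain ⟨U, hU, hSU, hnull⟩ := hW.exists_isOpen_nullhomotopic i hcl
    (ContinuousMap.Nullhomotopic.comp_left h q)
  refine ⟨Subtype.val '' U, hV.isOpenMap_subtype_val U hU,
    fun x hx => ⟨⟨x, hx.1⟩, hSU hx.2, rfl⟩, ?_⟩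
  have hv (x : ↥((Subtype.val : V → W) '' U)) : (x : W) ∈ V := by
    obtain ⟨v, -, hv⟩ := x.2
    exact hv ▸ v.2
  have hu (x : ↥((Subtype.val : V → W) '' U)) : (⟨x, hv x⟩ : V) ∈ U := by
    obtain ⟨v, hvU, hvx⟩ := x.2
    rwa [← show v = ⟨x, hv x⟩ from Subtype.ext hvx]
  let q' : C(↥((Subtype.val : V → W) '' U), U) := ⟨fun x => ⟨⟨x, hv x⟩, hu x⟩, by fun_prop⟩
  exact ContinuousMap.Nullhomotopic.comp_left hnull q'

/-! ### Closed filtrations as rank functions -/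

/-- A closed filtration encoded by the function sending a point to the stratum containing it. -/
theorem hasClosedFiltration_iff {X : Type u} [TopologicalSpace X] {P : Set X → Prop} {n : ℕ} :
    HasClosedFiltration X P n ↔ ∃ r : X → ℕ, (∀ x, r x < n) ∧ (∀ k, IsClosed {x | r x < k}) ∧
      ∀ k < n, P {x | r x = k} := by
  classical
  constructor
  · rintro ⟨Q, h0, hn, hmono, hcl, hP⟩
    have hex (x : X) : ∃ k, ∃ hk : k < n, x ∈ Q (Fin.succ ⟨k, hk⟩) := by
      rcases n with _ | n
      · exact absurd (hn ▸ mem_univ x : x ∈ Q (Fin.last 0)) (by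
          rw [show Fin.last 0 = 0 from rfl, h0]
          exact notMem_empty x)
      · exact ⟨n, n.lt_succ_self, by
          change x ∈ Q (Fin.last (n + 1))
          exact hn ▸ mem_univ x⟩
    have key (x : X) (k : Fin (n + 1)) : x ∈ Q k ↔ Nat.find (hex x) < k := by
      constructor
      · intro hx
        induction k using Fin.cases with
        | zero => exact absurd (h0 ▸ hx) (notMem_empty x)
        | succ k => exact Nat.lt_succ_of_le (Nat.find_min' (hex x) ⟨k.2, hx⟩)
      · intro hk
        obtain ⟨hlt, hx⟩ := Nat.find_spec (hex x)
        exact hmono (Fin.le_def.2 (Nat.succ_le_of_lt hk)) hx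
    refine ⟨fun x => Nat.find (hex x), fun x => (Nat.find_spec (hex x)).1, fun k => ?_,
      fun k hk => ?_⟩
    · rcases lt_or_ge n k with hk | hk
      · convert isClosed_univ
        exact eq_univ_of_forall fun x => (Nat.find_spec (hex x)).1.trans hk
      · convert hcl ⟨k, Nat.lt_succ_of_le hk⟩ using 1
        ext x
        exact (key x ⟨k, Nat.lt_succ_of_le hk⟩).symm
    · convert hP ⟨k, hk⟩ using 1
      ext x
      rw [mem_sdiff, key, key]
      simp only [mem_ofPred_eq, Fin.val_succ, Fin.val_castSucc]
      omega
  · rintro ⟨r, hr, hcl, hP⟩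
    refine ⟨fun k => {x | r x < k}, ?_, ?_, ?_, fun k => hcl k, fun k => ?_⟩
    · simp
    · exact eq_univ_of_forall hr
    · exact fun a b hab x hx => lt_of_lt_of_le hx (Fin.le_def.1 hab)
    · convert hP k k.2 using 1
      ext x
      simp only [mem_sdiff, mem_ofPred_eq, Fin.val_succ, Fin.val_castSucc]
      omega

theorem ENat.iInf_natCast_le {P : ℕ → Prop} {n : ℕ} (h : P n) :
    (⨅ (k : ℕ) (_ : P k), (k : ℕ∞)) ≤ n :=
  iInf₂_le n h

theorem ENat.exists_eq_of_iInf_ne_top {P : ℕ → Prop}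
    (h : (⨅ (k : ℕ) (_ : P k), (k : ℕ∞)) ≠ ⊤) :
    ∃ n, P n ∧ (⨅ (k : ℕ) (_ : P k), (k : ℕ∞)) = n := by
  classical
  have hex : ∃ k, P k := by
    by_contra! hP
    exact h (by simp [hP])
  refine ⟨Nat.find hex, Nat.find_spec hex, le_antisymm (iInf₂_le _ (Nat.find_spec hex)) ?_⟩
  exact le_iInf₂ fun k hk => Nat.cast_le.2 (Nat.find_min' hex hk)

theorem ENat.iInf_le_iInf_of_imp {P P' : ℕ → Prop} (h : ∀ n, P n → P' n) :
    (⨅ (k : ℕ) (_ : P' k), (k : ℕ∞)) ≤ ⨅ (k : ℕ) (_ : P k), (k : ℕ∞) :=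
  le_iInf₂ fun n hn => ENat.iInf_natCast_le (h n hn)

/-- An open cover by sets which deform to a point yields a closed filtration whose strata deform
to a point. -/
theorem hasClosedFiltration_deformsToPoint_of_openCover {X : Type u} [TopologicalSpace X] {n : ℕ}
    {U : Fin n → Set X} (hU : ∀ i, IsOpen (U i) ∧ DeformsToPoint (U i)) (hcov : ⋃ i, U i = univ) :
    HasClosedFiltration X DeformsToPoint n := by
  classical
  rw [hasClosedFiltration_iff]
  have hne (x : X) : (Finset.univ.filter fun i => x ∈ U i).Nonempty := by
    obtain ⟨i, hi⟩ := mem_iUnion.1 (hcov ▸ mem_univ x)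
    exact ⟨i, by simpa using hi⟩
  -- Taking the largest index makes rank below `k` mean avoiding every `U i` with `i ≥ k`, a closed
  -- condition.
  refine ⟨fun x => ((Finset.univ.filter fun i => x ∈ U i).max' (hne x) : Fin n),
    fun x => Fin.is_lt _, fun k => ?_, fun k hk => ?_⟩
  · have : {x | (((Finset.univ.filter fun i => x ∈ U i).max' (hne x) : Fin n) : ℕ) < k} =
        ⋂ (i : Fin n) (_ : k ≤ i), (U i)ᶜ := by
      ext x
      simp only [mem_ofPred_eq, mem_iInter, mem_compl_iff]
      constructor
      · intro h i hki hxi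
        have := Finset.le_max' (Finset.univ.filter fun i => x ∈ U i) i (by simpa using hxi)
        exact absurd (Fin.le_def.1 this) (by omega)
      · intro h
        by_contra! hk
        exact h _ hk (Finset.mem_filter.1 (Finset.max'_mem _ (hne x))).2
    rw [this]
    exact isClosed_biInter fun i _ => (hU i).1.isClosed_compl
  · refine (hU ⟨k, hk⟩).2.mono fun x hx => ?_
    have hx' : (Finset.univ.filter fun i => x ∈ U i).max' (hne x) = ⟨k, hk⟩ := Fin.ext hx
    exact hx' ▸ (Finset.mem_filter.1 (Finset.max'_mem _ (hne x))).2

/-! ### Partial and categorical sections -/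

section MapInvariants

variable {C : Type u} {W : Type v} [TopologicalSpace C] [TopologicalSpace W]

/-- Partial sections of the path projection correspond to maps homotopic to the first projection
which are liftings of the second one. -/
theorem hasPartialSection_iff {f : C(C, W)} {Q : Set (C × W)} :
    HasPartialSection f Q ↔ ∃ v : C(Q, C),
      ContinuousMap.Homotopic ⟨fun q => q.1.1, by fun_prop⟩ v ∧ ∀ q : Q, f (v q) = q.1.2 := by
  constructor
  · rintro ⟨s, hs⟩
    refine ⟨⟨fun q => s q 1, by fun_prop⟩, ⟨⟨⟨fun p => s p.2 p.1, by fun_prop⟩, fun q => ?_,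
      fun q => rfl⟩⟩, fun q => congrArg Prod.snd (hs q)⟩
    exact congrArg Prod.fst (hs q)
  · rintro ⟨v, ⟨H⟩, hv⟩
    refine ⟨(H.toContinuousMap.comp .prodSwap).curry, fun q => Prod.ext ?_ ?_⟩
    · exact H.apply_zero q
    · exact (congrArg f (H.apply_one q)).trans (hv q)

theorem HasPartialSection.mono {f : C(C, W)} {Q R : Set (C × W)} (hQR : Q ⊆ R)
    (h : HasPartialSection f R) : HasPartialSection f Q := by
  obtain ⟨s, hs⟩ := h
  exact ⟨s.comp (ContinuousMap.inclusion hQR), fun q => hs ⟨q, hQR q.2⟩⟩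

theorem hasPartialSection_empty (f : C(C, W)) : HasPartialSection f ∅ :=
  ⟨⟨isEmptyElim, continuous_of_discreteTopology⟩, isEmptyElim⟩

theorem HasCategoricalSection.deformsToPoint {f : C(C, W)} {A : Set W}
    (h : HasCategoricalSection f A) : DeformsToPoint A := by
  obtain ⟨s, hs, hnull⟩ := h
  have := (ContinuousMap.Nullhomotopic.comp_right hnull f).comp_left
    (⟨rangeFactorization s, by fun_prop⟩ : C(A, range s))
  have heq : (f.comp ⟨Subtype.val, continuous_subtype_val⟩).comp
      (⟨rangeFactorization s, by fun_prop⟩ : C(A, range s)) =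
      ⟨Subtype.val, continuous_subtype_val⟩ := ContinuousMap.ext hs
  rwa [heq] at this

/-- Put `s w = v (c₀, w)`. Each `c` in the image of `s` satisfies `c = v (c₀, f c)`, so pulling the
homotopy `pr₁ ≃ v` back along `c ↦ (c₀, f c)` joins the constant `c₀` to the inclusion. -/
theorem HasPartialSection.hasCategoricalSection {f : C(C, W)} {Q : Set (C × W)}
    (h : HasPartialSection f Q) (c₀ : C) : HasCategoricalSection f {w | (c₀, w) ∈ Q} := by
  obtain ⟨v, hv, hfv⟩ := hasPartialSection_iff.1 h
  let s : C({w | (c₀, w) ∈ Q}, C) := ⟨fun w => v ⟨(c₀, w), w.2⟩, by fun_prop⟩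
  have hs (w : {w | (c₀, w) ∈ Q}) : f (s w) = w := hfv ⟨(c₀, w), w.2⟩
  have hmem (c : range s) : (c₀, f c) ∈ Q := by
    obtain ⟨_, w, rfl⟩ := c
    rw [hs w]
    exact w.2
  refine ⟨s, hs, c₀, ?_⟩
  have := (hv.comp (ContinuousMap.Homotopic.refl
    (⟨fun c => ⟨(c₀, f c), hmem c⟩, by fun_prop⟩ : C(range s, Q)))).symm
  refine Eq.mp (congrArg₂ ContinuousMap.Homotopic ?_ rfl) this
  ext ⟨_, w, rfl⟩
  exact congrArg v (Subtype.ext (Prod.ext rfl (hs w)))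

theorem hasPartialSection_prod [PathConnectedSpace C] {f : C(C, W)} {S : Set C} {A : Set W}
    (hS : DeformsToPoint S) (hA : HasCategoricalSection f A) : HasPartialSection f (S ×ˢ A) := by
  obtain ⟨s, hs, c₂, h₂⟩ := hA
  obtain ⟨c₁, h₁⟩ := hS
  let p : C(S ×ˢ A, S) := ⟨fun q => ⟨q.1.1, q.2.1⟩, by fun_prop⟩
  let p' : C(S ×ˢ A, range s) := ⟨fun q => ⟨s ⟨q.1.2, q.2.2⟩, mem_range_self _⟩, by fun_prop⟩
  refine hasPartialSection_iff.2 ⟨⟨fun q => s ⟨q.1.2, q.2.2⟩, by fun_prop⟩, ?_, fun q => hs _⟩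
  have hc : (ContinuousMap.const (S ×ˢ A) c₁).Homotopic (ContinuousMap.const _ c₂) := by
    obtain ⟨γ⟩ := PathConnectedSpace.joined c₁ c₂
    exact ⟨γ.toHomotopyConst⟩
  exact ((h₁.comp (.refl p)).trans hc).trans (h₂.comp (.refl p')).symm

/-- Partial sections over the fibres of a locally constant function glue. -/
theorem HasPartialSection.of_fibers {f : C(C, W)} {Q : Set (C × W)} (g : C × W → ℕ)
    (hg : ∀ j, IsOpen {q : Q | g q = j}) (h : ∀ j, HasPartialSection f {p ∈ Q | g p = j}) :
    HasPartialSection f Q := by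
  choose s hs using h
  let S : ℕ → Set Q := fun j => {q | g q = j}
  let φ (j : ℕ) : C(S j, C(I, C)) :=
    (s j).comp ⟨fun q => ⟨q.1.1, q.1.2, q.2⟩, by fun_prop⟩
  let F := ContinuousMap.liftCover S φ
    (fun i j x hi hj => by
      obtain rfl : i = j := Eq.trans (Eq.symm hi) hj
      rfl)
    (fun x => ⟨g x, (hg _).mem_nhds rfl⟩)
  refine ⟨F, fun q => ?_⟩
  have hq : F q = φ (g q) ⟨q, rfl⟩ :=
    ContinuousMap.liftCover_coe (S := S) (φ := φ) (i := g q) ⟨q, rfl⟩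
  rw [hq]
  exact hs (g q) ⟨q.1, q.2, rfl⟩

/-! ### The inequalities -/

theorem lsCat_le_csec (hW : IsMetricANR W) (f : C(C, W)) : lsCat W ≤ csec f := by
  refine ENat.iInf_le_iInf_of_imp fun n hn => ?_
  obtain ⟨r, hr, hcl, hP⟩ := hasClosedFiltration_iff.1 hn
  have hex (k : Fin n) : ∃ U : Set W, IsOpen U ∧ {w | r w = k} ⊆ U ∧ DeformsToPoint U := by
    refine DeformsToPoint.exists_isOpen_superset hW ?_ (hP k k.2).deformsToPoint
    refine ⟨{w | r w < k}ᶜ, {w | r w < k + 1}, (hcl k).isOpen_compl, hcl _, ?_⟩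
    ext w
    simp only [mem_inter_iff, mem_compl_iff, mem_ofPred_eq]
    omega
  choose U hU hsub hdef using hex
  exact ⟨U, fun i => ⟨hU i, hdef i⟩,
    eq_univ_of_forall fun w => mem_iUnion.2 ⟨⟨r w, hr w⟩, hsub ⟨r w, hr w⟩ rfl⟩⟩

theorem csec_le_mapTC [Nonempty C] (f : C(C, W)) : csec f ≤ mapTC f := by
  obtain ⟨c₀⟩ := ‹Nonempty C›
  refine ENat.iInf_le_iInf_of_imp fun n hn => ?_
  obtain ⟨r, hr, hcl, hP⟩ := hasClosedFiltration_iff.1 hn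
  exact hasClosedFiltration_iff.2 ⟨fun w => r (c₀, w), fun w => hr _,
    fun k => (hcl k).preimage (Continuous.prodMk_right c₀),
    fun k hk => (hP k hk).hasCategoricalSection c₀⟩

/-- The rank of `(c, w)` is the sum of the two ranks, which is at most `(m - 1) + (n - 1)`, leaving
`n + m - 1` strata. Each stratum is a topologically disjoint union of products of strata. -/
theorem hasClosedFiltration_hasPartialSection [PathConnectedSpace C] {f : C(C, W)} {n m : ℕ}
    (hn : HasClosedFiltration W (HasCategoricalSection f) n)
    (hm : HasClosedFiltration C DeformsToPoint m) :
    HasClosedFiltration (C × W) (HasPartialSection f) (n + m - 1) := by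
  obtain ⟨a, ha, hacl, haP⟩ := hasClosedFiltration_iff.1 hn
  obtain ⟨b, hb, hbcl, hbP⟩ := hasClosedFiltration_iff.1 hm
  refine hasClosedFiltration_iff.2 ⟨fun p => b p.1 + a p.2, fun p => ?_, fun k => ?_,
    fun k _ => ?_⟩
  · have := ha p.2
    have := hb p.1
    change b p.1 + a p.2 < n + m - 1
    omega
  · have : {p : C × W | b p.1 + a p.2 < k} =
        ⋃ j ∈ Finset.range k, {p : C × W | b p.1 < j + 1} ∩ {p : C × W | a p.2 < k - j} := by
      ext p
      simp only [mem_ofPred_eq, mem_iUnion, mem_inter_iff, Finset.mem_range, exists_prop]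
      exact ⟨fun h => ⟨b p.1, by omega⟩, fun ⟨j, h⟩ => by omega⟩
    rw [this]
    exact isClosed_biUnion_finset fun j _ =>
      ((hbcl _).preimage continuous_fst).inter ((hacl _).preimage continuous_snd)
  · refine HasPartialSection.of_fibers (fun p => b p.1) (fun j => ?_) fun j => ?_
    · have : {q : {p : C × W | b p.1 + a p.2 = k} | b q.1.1 = j} =
          {q | b q.1.1 < j}ᶜ ∩ {q | a q.1.2 < k - j}ᶜ := by
        ext ⟨p, hp : b p.1 + a p.2 = k⟩
        simp only [mem_ofPred_eq, mem_inter_iff, mem_compl_iff]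
        omega
      rw [this]
      exact ((hbcl j).preimage (continuous_fst.comp continuous_subtype_val)).isOpen_compl.inter
        ((hacl (k - j)).preimage (continuous_snd.comp continuous_subtype_val)).isOpen_compl
    · by_cases hj : j < m ∧ j ≤ k ∧ k - j < n
      · refine (hasPartialSection_prod (hbP j hj.1) (haP (k - j) hj.2.2)).mono ?_
        rintro p ⟨hp : b p.1 + a p.2 = k, hpj : b p.1 = j⟩
        exact ⟨hpj, show a p.2 = k - j by omega⟩
      · convert hasPartialSection_empty f
        refine eq_empty_of_forall_notMem ?_
        rintro p ⟨hp : b p.1 + a p.2 = k, hpj : b p.1 = j⟩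
        have := ha p.2
        have := hb p.1
        omega

theorem mapTC_lt_csec_add_lsCat [PathConnectedSpace C] {f : C(C, W)}
    (h : csec f + lsCat C ≠ ⊤) : mapTC f < csec f + lsCat C := by
  obtain ⟨n, hn, hn'⟩ := ENat.exists_eq_of_iInf_ne_top (ne_top_of_le_ne_top h le_self_add)
  obtain ⟨m, ⟨U, hU, hcov⟩, hm'⟩ :=
    ENat.exists_eq_of_iInf_ne_top (ne_top_of_le_ne_top h le_add_self)
  have hm := hasClosedFiltration_deformsToPoint_of_openCover hU hcov
  -- As `C` is nonempty, `m` is positive, so the truncated `n + m - 1` is strictly below `n + m`.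
  have hpos : 0 < m := by
    obtain ⟨c⟩ := PathConnectedSpace.nonempty (X := C)
    obtain ⟨b, hb, -⟩ := hasClosedFiltration_iff.1 hm
    exact (Nat.zero_le _).trans_lt (hb c)
  rw [csec, hn', lsCat, hm']
  refine (ENat.iInf_natCast_le (hasClosedFiltration_hasPartialSection hn hm)).trans_lt ?_
  exact_mod_cast (by omega : n + m - 1 < n + m)

end MapInvariants

theorem mainTheorem1 {C : Type u} {W : Type v} [TopologicalSpace C] [TopologicalSpace W]
    [PathConnectedSpace C] (hW : IsMetricANR W) (f : C(C, W)) :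
    lsCat W ≤ csec f ∧ csec f ≤ mapTC f ∧
      (csec f + lsCat C ≠ ⊤ → mapTC f < csec f + lsCat C) :=
  ⟨lsCat_le_csec hW f, csec_le_mapTC f, mapTC_lt_csec_add_lsCat⟩
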